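/- Let $G$ be a countable discrete group acting continuously (by homeomorphisms) on a compact metrizable space $X$. For a closed set $F\subset X$ and an open set $O\subset X$ write $F\prec O$ if there are a finite collection $\mathcal U$ of open subsets of $X$ covering $F$ and elements $s_U\in G$ $(U\in\mathcal U)$ such that the sets $s_UU$ $(U\in\mathcal U)$ are pairwise disjoint subsets of $O$. For open sets $A,B$ write $A\prec B$ if $F\prec B$ for every closed $F\subset A$. For open sets $A,B$ and integers $p,q\ge 1$ write $pA\prec qB$ if for all closed sets $F_1,\dots,F_p\subset A$ there are, for each $i\in\{1,\dots,p\}$, open sets $U^{(i)}_1,\dots,U^{(i)}_{J_i}$ covering $F_i$, elements $s^{(i)}_1,\dots,s^{(i)}_{J_i}\in G$ and indices $k^{(i)}_1,\dots,k^{(i)}_{J_i}\in\{1,\dots,q\}$ such that the sets $s^{(i)}_jU^{(i)}_j\times\{k^{(i)}_j\}$ $(1\le i\le p,\ 1\le j\le J_i)$ are pairwise disjoint subsets of $B\times\{1,\dots,q\}$. Let $\mathcal A_0$ be the algebra of subsets of $X$ generated by the open sets, and let $\operatorname{Pr}_G(X)$ be the set of all $\mu:\mathcal A_0\to[0,\infty]$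 such that $\mu(\emptyset)=0$; $\mu(\bigsqcup_{n}A_n)=\sum_{n}\mu(A_n)$ for every sequence of pairwise disjoint $A_n\in\mathcal A_0$ whose union lies in $\mathcal A_0$; $\mu(gB)=\mu(B)$ for all $g\in G$, $B\in\mathcal A_0$; and, for all $B\in\mathcal A_0$, $\mu(B)=\sup\{\mu(F):F\subset B,\ F\text{ compact}\}=\inf\{\mu(O):B\subset O,\ O\text{ open}\}$. The action has \emph{generalized dynamical comparison} if $A\prec B$ holds whenever $A,B\subset X$ are open sets such that $A\subset G\cdot B=\bigcup_{g\in G}gB$ and $\mu(A)<1$ for every $\mu\in\operatorname{Pr}_G(X)$ with $\mu(B)=1$. \textbf{Theorem B.} The following are equivalent. (i) For all nonempty open sets $A,B\subset X$, if $(n+1)A\prec nB$ for some integer $n\ge 1$, then $A\prec B$. (ii) The action has generalized dynamical comparison. -/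

import Mathlib

open scoped Pointwise ENNReal
open MeasureTheory (generateSetAlgebra)

namespace GenComparison

/-- `F ≺ O` for a closed set `F` and an open set `O`: there is a finite collection `𝒰` of open
sets covering `F` and for each `U ∈ 𝒰` a group element `s U` such that the translates
`s U • U` are pairwise disjoint subsets of `O`. -/
def ClosedPrec (G : Type*) {X : Type*} [Group G] [MulAction G X] [TopologicalSpace X]
    (F O : Set X) : Prop :=
  ∃ (𝒰 : Finset (Set X)) (s : Set X → G),
    (∀ U ∈ 𝒰, IsOpen U) ∧
    F ⊆ ⋃ U ∈ 𝒰, U ∧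
    (∀ U ∈ 𝒰, s U • U ⊆ O) ∧
    (𝒰 : Set (Set X)).PairwiseDisjoint (fun U => s U • U)

/-- `A ≺ B` for open sets `A`, `B`: `F ≺ B` for every closed subset `F` of `A`. -/
def OpenPrec (G : Type*) {X : Type*} [Group G] [MulAction G X] [TopologicalSpace X]
    (A B : Set X) : Prop :=
  ∀ F : Set X, IsClosed F → F ⊆ A → ClosedPrec G F B

/-- The subset `⨆ₗ V l × {l}` of `X × {1, …, m}`. -/
def levels {X : Type*} {m : ℕ} (V : Fin m → Set X) : Set (X × Fin m) :=
  ⋃ l, V l ×ˢ {l}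

/-- The relation `⨆ᵢ O i × {i} ≺ ⨆ₗ V l × {l}` between two finite sequences of open sets: for all
closed `F i ⊆ O i` there are, for each `i`, finitely many open sets `U i j` covering `F i`, group
elements `s i j` and levels `k i j`, such that the sets `(s i j • U i j) × {k i j}` are pairwise
disjoint, over all pairs `(i, j)`, and contained in `⨆ₗ V l × {l}`. -/
def SeqPrec (G : Type*) {X : Type*} [Group G] [MulAction G X] [TopologicalSpace X]
    {n m : ℕ} (O : Fin n → Set X) (V : Fin m → Set X) : Prop :=
  ∀ F : Fin n → Set X, (∀ i, IsClosed (F i)) → (∀ i, F i ⊆ O i) →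
    ∃ (J : Fin n → ℕ) (U : (i : Fin n) → Fin (J i) → Set X)
      (s : (i : Fin n) → Fin (J i) → G) (k : (i : Fin n) → Fin (J i) → Fin m),
      (∀ i j, IsOpen (U i j)) ∧
      (∀ i, F i ⊆ ⋃ j, U i j) ∧
      Pairwise (Function.onFun Disjoint
        (fun p : (i : Fin n) × Fin (J i) =>
          (s p.1 p.2 • U p.1 p.2) ×ˢ ({k p.1 p.2} : Set (Fin m)))) ∧
      (⋃ i, ⋃ j, (s i j • U i j) ×ˢ ({k i j} : Set (Fin m))) ⊆ levels V

/-- `p A ≺ q B`: `p` copies of `A` are subequivalent to `q` copies of `B`. -/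
def MultPrec (G : Type*) {X : Type*} [Group G] [MulAction G X] [TopologicalSpace X]
    (p : ℕ) (A : Set X) (q : ℕ) (B : Set X) : Prop :=
  SeqPrec G (fun _ : Fin p => A) (fun _ : Fin q => B)

/-- The algebra of subsets of `X` generated by the open sets. -/
def openAlgebra (X : Type*) [TopologicalSpace X] : Set (Set X) :=
  generateSetAlgebra {O : Set X | IsOpen O}

/-- `μ` is a premeasure on the algebra `𝒜`. Only the values of `μ` on members of `𝒜` matter. -/
structure IsPremeasure {X : Type*} (𝒜 : Set (Set X)) (μ : Set X → ℝ≥0∞) : Prop where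
  empty : μ ∅ = 0
  iUnion : ∀ A : ℕ → Set X, (∀ n, A n ∈ 𝒜) → Pairwise (Function.onFun Disjoint A) →
    (⋃ n, A n) ∈ 𝒜 → μ (⋃ n, A n) = ∑' n, μ (A n)

/-- `μ` is a `G`-invariant regular premeasure on the algebra generated by the open sets. -/
structure IsInvariantRegularPremeasure (G : Type*) {X : Type*} [Group G] [MulAction G X]
    [TopologicalSpace X] (μ : Set X → ℝ≥0∞) : Prop where
  isPremeasure : IsPremeasure (openAlgebra X) μ
  invariant : ∀ (g : G), ∀ B ∈ openAlgebra X, μ (g • B) = μ B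
  innerRegular : ∀ B ∈ openAlgebra X, μ B = ⨆ (F : Set X) (_ : F ⊆ B) (_ : IsCompact F), μ F
  outerRegular : ∀ B ∈ openAlgebra X, μ B = ⨅ (O : Set X) (_ : B ⊆ O) (_ : IsOpen O), μ O

/-- Generalized dynamical comparison of the action of `G` on `X`. -/
def HasGeneralizedDynamicalComparison (G X : Type*) [Group G] [MulAction G X]
    [TopologicalSpace X] : Prop :=
  ∀ A B : Set X, IsOpen A → IsOpen B →
    A ⊆ (⋃ g : G, g • B) →
    (∀ μ : Set X → ℝ≥0∞, IsInvariantRegularPremeasure G μ → μ B = 1 → μ A < 1) →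
    OpenPrec G A B

end GenComparison

/-!
The substance is the passage from (i) to comparison. If `(n + 1) A ≺ n B` holds for some `n`, then
an invariant premeasure with `μ B = 1` satisfies `μ F ≤ n / (n + 1)` for all closed `F ⊆ A`
(`MultPrec.mul_le`), hence `μ A < 1`; this is the easy direction. Conversely, let the hypotheses of
comparison hold for `A` and `B`, let `F ⊆ A` be closed, and pick an open `A'` with
`F ⊆ A' ⊆ closure A' ⊆ A`. By (i) it is enough to find `n` with `(n + 1) A' ≺ n B`, and if there is
none, an invariant premeasure with `μ B = 1 ≤ μ A` is constructed as follows.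

* Finite families of arbitrary subsets of `X` are preordered by `FamilySubeq`: the left-hand sets
  have open covers which can be moved disjointly into any open neighbourhoods of the right-hand
  sets. This gives a translation-invariant preorder on multisets of sets, for which a union is at
  most the sum, and equal to the sum for disjoint compact sets.
* On the sets covered by finitely many translates of `B`, the set `B` is an order unit. By
  hypothesis no inequality `(n + 1) [closure A'] ≤ n [B]` holds, so there is a monotone additive
  real functional with `φ [B] = 1 ≤ φ [closure A']` (`exists_functional_one_le`). It comes from the
  Riesz extension theorem in the rational vector space on the generators
  (`rational_riesz_extension`); rational coefficients allow denominators to be cleared, which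
  turns membership in the cone into an inequality between multisets.
* On the compact subsets of the locally compact set `G • B` the functional is an invariant content,
  whose measure `ν` is regular with `ν B ≤ 1 ≤ ν (closure A')` (`exists_invariant_measure`). As `G`
  is countable, `ν B > 0`, so `ν` can be normalized at `B`. Giving the value `∞` to all sets not
  contained in `G • B` yields an invariant regular premeasure on all of `X`
  (`isInvariantRegularPremeasure_extendByTop`).
-/

namespace GenComparison

/-! ### Rational cones and real functionals -/

section RationalRiesz

open Set Submodule

variable {E : Type*} [AddCommGroup E] [Module ℚ E]

/-- One-step extension: a functional nonnegative on the cone extends to the span of its domain and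
one further vector. -/
theorem rational_riesz_step (s : PointedCone ℚ E) (f : E →ₗ.[ℚ] ℝ)
    (nonneg : ∀ x : f.domain, (x : E) ∈ s → 0 ≤ f x)
    (dense : ∀ y, ∃ x : f.domain, (x : E) + y ∈ s) (hdom : f.domain ≠ ⊤) :
    ∃ g, f < g ∧ ∀ x : g.domain, (x : E) ∈ s → 0 ≤ g x := by
  obtain ⟨y, -, hy⟩ : ∃ y ∈ ⊤, y ∉ f.domain := SetLike.exists_of_lt (lt_top_iff_ne_top.2 hdom)
  obtain ⟨c, le_c, c_le⟩ :
      ∃ c, (∀ x : f.domain, -(x : E) - y ∈ s → f x ≤ c) ∧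
        ∀ x : f.domain, (x : E) + y ∈ s → c ≤ f x := by
    set Sp := f '' { x : f.domain | (x : E) + y ∈ s }
    set Sn := f '' { x : f.domain | -(x : E) - y ∈ s }
    suffices (upperBounds Sn ∩ lowerBounds Sp).Nonempty by
      simpa only [Sp, Sn, Set.Nonempty, upperBounds, lowerBounds, forall_mem_image] using! this
    refine exists_between_of_forall_le (Nonempty.image f ?_) (Nonempty.image f (dense y)) ?_
    · rcases dense (-y) with ⟨x, hx⟩
      rw [← neg_neg x, NegMemClass.coe_neg, ← sub_eq_add_neg] at hx
      exact ⟨_, hx⟩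
    rintro a ⟨xn, hxn, rfl⟩ b ⟨xp, hxp, rfl⟩
    have := s.add_mem hxp hxn
    rw [add_assoc, add_sub_cancel, ← sub_eq_add_neg, ← AddSubgroupClass.coe_sub] at this
    replace := nonneg _ this
    rwa [f.map_sub, sub_nonneg] at this
  refine ⟨f.supSpanSingleton y (-c) hy, ?_, ?_⟩
  · refine lt_iff_le_not_ge.2 ⟨f.left_le_sup _ _, fun H => ?_⟩
    replace H := LinearPMap.domain_mono.monotone H
    rw [LinearPMap.domain_supSpanSingleton, sup_le_iff, span_le, singleton_subset_iff] at H
    exact hy H.2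
  · rintro ⟨z, hz⟩ hzs
    rcases mem_sup.1 hz with ⟨x, hx, y', hy', rfl⟩
    rcases mem_span_singleton.1 hy' with ⟨r, rfl⟩
    simp only at hzs
    rw [LinearPMap.supSpanSingleton_apply_mk _ _ _ _ _ hx, smul_neg, ← sub_eq_add_neg, sub_nonneg]
    simp only [RingHom.id_apply]
    rcases lt_trichotomy r 0 with (hr | hr | hr)
    · have : -(r⁻¹ • x) - y ∈ s := by
        rwa [← s.smul_mem_iff (neg_pos.2 hr), smul_sub, smul_neg, neg_smul, neg_neg, smul_smul,
          mul_inv_cancel₀ hr.ne, one_smul, sub_eq_add_neg, neg_smul, neg_neg]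
      replace := le_c (r⁻¹ • ⟨x, hx⟩) this
      rw [f.map_smul] at this
      have h2 := smul_le_smul_of_nonpos_left this hr.le
      rwa [smul_smul, mul_inv_cancel₀ hr.ne, one_smul] at h2
    · subst r
      simp only [zero_smul, add_zero] at hzs ⊢
      apply nonneg
      exact hzs
    · have : r⁻¹ • x + y ∈ s := by
        rwa [← s.smul_mem_iff hr, smul_add, smul_smul, mul_inv_cancel₀ hr.ne', one_smul]
      replace := c_le (r⁻¹ • ⟨x, hx⟩) this
      rw [f.map_smul] at this
      have h2 := smul_le_smul_of_nonneg_left this hr.le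
      rwa [smul_smul, mul_inv_cancel₀ hr.ne', one_smul] at h2

/-- The M. Riesz extension theorem for a cone in a rational vector space and functionals with
values in `ℝ`; Mathlib's `riesz_extension` is the case of real vector spaces. Completeness is only
needed in the target. -/
theorem rational_riesz_extension (s : PointedCone ℚ E) (p : E →ₗ.[ℚ] ℝ)
    (hp_nonneg : ∀ x : p.domain, (x : E) ∈ s → 0 ≤ p x)
    (hp_dense : ∀ y, ∃ x : p.domain, (x : E) + y ∈ s) :
    ∃ g : E →ₗ[ℚ] ℝ, (∀ x : p.domain, g x = p x) ∧ ∀ x ∈ s, 0 ≤ g x := by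
  set S := { p : E →ₗ.[ℚ] ℝ | ∀ x : p.domain, (x : E) ∈ s → 0 ≤ p x }
  have hSc : ∀ c, c ⊆ S → IsChain (· ≤ ·) c → ∀ y ∈ c, ∃ ub ∈ S, ∀ z ∈ c, z ≤ ub := by
    intro c hcs c_chain y hy
    have cne : c.Nonempty := ⟨y, hy⟩
    have hcd : DirectedOn (· ≤ ·) c := c_chain.directedOn
    refine ⟨LinearPMap.sSup c hcd, ?_, fun _ ↦ LinearPMap.le_sSup hcd⟩
    rintro ⟨x, hx⟩ hxs
    have hdir : DirectedOn (· ≤ ·) (LinearPMap.domain '' c) :=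
      directedOn_image.2 (hcd.mono LinearPMap.domain_mono.monotone)
    rcases (mem_sSup_of_directed (cne.image _) hdir).1 hx with ⟨_, ⟨f, hfc, rfl⟩, hfx⟩
    have : f ≤ LinearPMap.sSup c hcd := LinearPMap.le_sSup _ hfc
    convert! ← hcs hfc ⟨x, hfx⟩ hxs using 1
    exact this.2 rfl
  obtain ⟨q, hpq, hqs, hq⟩ := zorn_le_nonempty₀ S hSc p hp_nonneg
  have htop : q.domain = ⊤ := by
    contrapose! hq
    have hqd : ∀ y, ∃ x : q.domain, (x : E) + y ∈ s := fun y ↦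
      let ⟨x, hx⟩ := hp_dense y
      ⟨Submodule.inclusion hpq.left x, hx⟩
    rcases rational_riesz_step s q hqs hqd hq with ⟨r, hqr, hr⟩
    exact ⟨r, hr, hqr.le, fun hrq ↦ hqr.ne' <| hrq.antisymm hqr.le⟩
  have hmem : ∀ x : E, x ∈ q.domain := fun x => htop ▸ mem_top
  refine ⟨q.toFun.comp (LinearMap.codRestrict q.domain LinearMap.id hmem), fun x => ?_,
    fun x hx => hqs ⟨x, hmem x⟩ hx⟩
  exact (hpq.2 rfl).symm

end RationalRiesz

/-! ### Additive functionals on preordered multisets -/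

section Functional

variable {ι : Type*}

/-- The embedding of multisets, as nonnegative integral vectors, into a rational vector space. -/
noncomputable def multisetVec (ι : Type*) : Multiset ι →+ (ι →₀ ℚ) :=
  Multiset.sumAddMonoidHom.comp (Multiset.mapAddMonoidHom fun i => Finsupp.single i (1 : ℚ))

theorem multisetVec_singleton (i : ι) : multisetVec ι {i} = Finsupp.single i 1 := by
  simp [multisetVec]

open Classical in
theorem multisetVec_apply (x : Multiset ι) (i : ι) : multisetVec ι x i = x.count i := by
  induction x using Multiset.induction with
  | empty => simp
  | cons a x ih =>
    rw [← Multiset.singleton_add, map_add, Finsupp.add_apply, ih, multisetVec_singleton,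
      Multiset.count_add, Multiset.count_singleton, Finsupp.single_apply]
    simp only [eq_comm, Nat.cast_add, Nat.cast_ite, Nat.cast_one, Nat.cast_zero]

theorem multisetVec_injective : Function.Injective (multisetVec ι) := by
  classical
  intro x y h
  ext i
  have := DFunLike.congr_fun h i
  rw [multisetVec_apply, multisetVec_apply] at this
  exact_mod_cast this

theorem exists_smul_add_multisetVec (v : ι →₀ ℚ) :
    ∃ (N : ℕ) (x y : Multiset ι), 0 < N ∧ (N : ℚ) • v + multisetVec ι x = multisetVec ι y := by
  induction v using Finsupp.induction_linear with
  | zero => exact ⟨1, 0, 0, one_pos, by simp⟩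
  | add v w hv hw =>
    obtain ⟨N, x, y, hN, h⟩ := hv
    obtain ⟨M, z, t, hM, h'⟩ := hw
    refine ⟨N * M, M • x + N • z, M • y + N • t, Nat.mul_pos hN hM, ?_⟩
    simp only [map_add, map_nsmul, ← h, ← h', ← Nat.cast_smul_eq_nsmul ℚ]
    push_cast
    module
  | single i q =>
    refine ⟨q.den, (-q.num).toNat • {i}, q.num.toNat • {i}, q.den_pos, ?_⟩
    simp only [map_nsmul, multisetVec_singleton, ← Nat.cast_smul_eq_nsmul ℚ, Finsupp.smul_single,
      smul_eq_mul, mul_one, ← Finsupp.single_add]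
    congr 1
    have h1 : ((q.num.toNat : ℤ) : ℚ) - (((-q.num).toNat : ℤ) : ℚ) = q.num := by
      exact_mod_cast Int.toNat_sub_toNat_neg q.num
    rw [Rat.den_mul_eq_num]
    push_cast at h1
    linarith

theorem rel_nsmul {W : Type*} [AddCommMonoid W] {R : W → W → Prop} (hzero : ∀ x, R 0 x)
    (hadd : ∀ x y z t, R x y → R z t → R (x + z) (y + t)) {x y : W} (h : R x y) (k : ℕ) :
    R (k • x) (k • y) := by
  induction k with
  | zero => simpa using hzero 0
  | succ k ih => simpa only [succ_nsmul] using hadd _ _ _ _ ih h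

theorem exists_rel_nsmul_singleton {R : Multiset ι → Multiset ι → Prop} (hzero : ∀ x, R 0 x)
    (hadd : ∀ x y z t, R x y → R z t → R (x + z) (y + t)) {b : ι}
    (hbdd : ∀ i, ∃ m : ℕ, R {i} (m • {b})) (x : Multiset ι) : ∃ m : ℕ, R x (m • {b}) := by
  induction x using Multiset.induction with
  | empty => exact ⟨0, hzero _⟩
  | cons a x ih =>
    obtain ⟨m, hm⟩ := ih
    obtain ⟨n, hn⟩ := hbdd a
    exact ⟨n + m, by simpa only [← Multiset.singleton_add, add_nsmul] using hadd _ _ _ _ hn hm⟩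

/-- An additive relation on multisets with order unit `b` admits a monotone additive functional
normalized at `b`, as soon as no multiset is related to one obtained from it by removing copies
of `b`. -/
theorem exists_functional {R : Multiset ι → Multiset ι → Prop} (hzero : ∀ x, R 0 x)
    (hadd : ∀ x y z t, R x y → R z t → R (x + z) (y + t)) (b : ι)
    (hbdd : ∀ i, ∃ m : ℕ, R {i} (m • {b}))
    (hstrict : ∀ (N : ℕ) (y : Multiset ι), 0 < N → ¬ R (N • {b} + y) y) :
    ∃ φ : ι → ℝ, (∀ x y, R x y → (x.map φ).sum ≤ (y.map φ).sum) ∧ φ b = 1 := by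
  let s : PointedCone ℚ (ι →₀ ℚ) :=
    { carrier := {v | ∃ (N : ℕ) (x y : Multiset ι), 0 < N ∧ R x y ∧
        (N : ℚ) • v + multisetVec ι x = multisetVec ι y}
      add_mem' := by
        rintro v w ⟨N, x, y, hN, hR, h⟩ ⟨M, z, t, hM, hR', h'⟩
        refine ⟨N * M, M • x + N • z, M • y + N • t, Nat.mul_pos hN hM,
          hadd _ _ _ _ (rel_nsmul hzero hadd hR M) (rel_nsmul hzero hadd hR' N), ?_⟩
        simp only [map_add, map_nsmul, ← h, ← h', ← Nat.cast_smul_eq_nsmul ℚ]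
        push_cast
        module
      zero_mem' := ⟨1, 0, 0, one_pos, hzero 0, by simp⟩
      smul_mem' := by
        rintro ⟨c, hc⟩ v ⟨N, x, y, hN, hR, h⟩
        refine ⟨c.den * N, c.num.toNat • x, c.num.toNat • y, Nat.mul_pos c.den_pos hN,
          rel_nsmul hzero hadd hR _, ?_⟩
        have h1 : ((c.num.toNat : ℕ) : ℚ) = c.den * c := by
          rw [Rat.den_mul_eq_num]
          exact_mod_cast Int.toNat_of_nonneg (Rat.num_nonneg.2 hc)
        simp only [map_nsmul, ← h, ← Nat.cast_smul_eq_nsmul ℚ, h1, Nonneg.mk_smul]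
        push_cast
        module }
  have hb0 : Finsupp.single b (1 : ℚ) ≠ 0 := by simp
  set p : (ι →₀ ℚ) →ₗ.[ℚ] ℝ := LinearPMap.mkSpanSingleton (Finsupp.single b (1 : ℚ)) (1 : ℝ) hb0
  have hnonneg : ∀ x : p.domain, (x : ι →₀ ℚ) ∈ s → 0 ≤ p x := by
    rintro ⟨v, hv⟩ hvs
    obtain ⟨t, rfl⟩ := Submodule.mem_span_singleton.1 hv
    have e : p ⟨t • Finsupp.single b (1 : ℚ), hv⟩ = t • (1 : ℝ) :=
      LinearPMap.mkSpanSingleton'_apply _ _ _ _ _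
    rw [e]
    by_contra! ht
    have ht0 : t < 0 := by
      by_contra! h0
      exact absurd ht (not_lt.2 (smul_nonneg h0 zero_le_one))
    obtain ⟨N, x, y, hN, hR, h⟩ := hvs
    have hnum : ((-t.num).toNat : ℚ) = - (t.den * t) := by
      rw [Rat.den_mul_eq_num]
      have : 0 ≤ -t.num := by
        have := Rat.num_neg.2 ht0
        omega
      exact_mod_cast Int.toNat_of_nonneg this
    have hnum0 : 0 < (-t.num).toNat := by
      have := Rat.num_neg.2 ht0
      omega
    refine hstrict (N * (-t.num).toNat) (t.den • y) (Nat.mul_pos hN hnum0) ?_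
    have hx : t.den • x = (N * (-t.num).toNat) • {b} + t.den • y := by
      apply multisetVec_injective
      simp only [map_add, map_nsmul, ← h, ← Nat.cast_smul_eq_nsmul ℚ, multisetVec_singleton]
      push_cast
      rw [hnum]
      module
    rw [← hx]
    exact rel_nsmul hzero hadd hR _
  have hdense : ∀ v, ∃ x : p.domain, (x : ι →₀ ℚ) + v ∈ s := by
    intro v
    obtain ⟨N, x, y, hN, h⟩ := exists_smul_add_multisetVec v
    obtain ⟨m, hm⟩ := exists_rel_nsmul_singleton hzero hadd hbdd x
    refine ⟨⟨((m : ℚ) / N) • Finsupp.single b 1, Submodule.smul_mem _ _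
      (Submodule.mem_span_singleton_self _)⟩, N, x, m • {b} + y, hN, ?_, ?_⟩
    · simpa using hadd _ _ _ _ hm (hzero y)
    · have hN' : (N : ℚ) ≠ 0 := by positivity
      simp only [map_add, map_nsmul, ← h, ← Nat.cast_smul_eq_nsmul ℚ, multisetVec_singleton,
        smul_add, smul_smul, mul_div_cancel₀ _ hN']
      abel
  obtain ⟨g, hg, hgs⟩ := rational_riesz_extension s p hnonneg hdense
  refine ⟨fun i => g (Finsupp.single i 1), ?_, ?_⟩
  · have key : ∀ x : Multiset ι, (x.map fun i => g (Finsupp.single i 1)).sum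
        = g (multisetVec ι x) := by
      intro x
      simp [multisetVec, map_multiset_sum]
    intro x y hxy
    rw [key, key]
    have : 0 ≤ g (multisetVec ι y - multisetVec ι x) := by
      refine hgs _ ⟨1, x, y, one_pos, hxy, by simp⟩
    rw [map_sub] at this
    linarith
  · exact (hg ⟨Finsupp.single b (1 : ℚ), Submodule.mem_span_singleton_self _⟩).trans
      (LinearPMap.mkSpanSingleton_apply _ _ hb0 _)

/-- If no inequality `(n + 1) f ≤ n b` holds in a positively preordered free commutative monoid
with order unit `b`, then some monotone additive functional has `φ b = 1 ≤ φ f`. -/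
theorem exists_functional_one_le {R : Multiset ι → Multiset ι → Prop} (hrefl : ∀ x, R x x)
    (htrans : ∀ x y z, R x y → R y z → R x z) (hzero : ∀ x, R 0 x)
    (hadd : ∀ x y z t, R x y → R z t → R (x + z) (y + t)) (b f : ι)
    (hbdd : ∀ i, ∃ m : ℕ, R {i} (m • {b}))
    (hnot : ∀ n : ℕ, 0 < n → ¬ R ((n + 1) • {f}) (n • {b})) :
    ∃ φ : ι → ℝ, (∀ x y, R x y → (x.map φ).sum ≤ (y.map φ).sum) ∧ φ b = 1 ∧ 1 ≤ φ f := by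
  have hle : ∀ x y, x ≤ y → R x y := by
    intro x y h
    obtain ⟨z, rfl⟩ := Multiset.le_iff_exists_add.1 h
    simpa using hadd _ _ _ _ (hrefl x) (hzero z)
  -- The relation generated by `R` and the additional inequality `b ≤ f`.
  let R' : Multiset ι → Multiset ι → Prop := fun x y =>
    ∃ (a : ℕ) (x₀ y₀ : Multiset ι), R x₀ y₀ ∧ x = x₀ + a • {b} ∧ y = y₀ + a • {f}
  have hRR' : ∀ x y, R x y → R' x y := fun x y h => ⟨0, x, y, h, by simp, by simp⟩
  have hadd' : ∀ x y z t, R' x y → R' z t → R' (x + z) (y + t) := by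
    rintro _ _ _ _ ⟨a, x, y, h, rfl, rfl⟩ ⟨a', x', y', h', rfl, rfl⟩
    exact ⟨a + a', x + x', y + y', hadd _ _ _ _ h h', by rw [add_nsmul]; abel,
      by rw [add_nsmul]; abel⟩
  have hstrict : ∀ (N : ℕ) (y : Multiset ι), 0 < N → ¬ R' (N • {b} + y) y := by
    rintro N y hN ⟨a, x₀, y₀, hR, h1, rfl⟩
    -- Adding `y₀ + N b + a f = x₀ + a b` to `x₀ ≤ y₀` and iterating makes the surplus grow linearly,
    -- while the error term `x₀` stays fixed.
    have iter : ∀ k : ℕ, R (x₀ + k • (N • {b} + a • {f})) (x₀ + k • a • {b}) := by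
      intro k
      induction k with
      | zero => simpa using hrefl x₀
      | succ k ih =>
        have h2 := hadd _ _ _ _ ih (hrefl (N • {b} + a • {f}))
        have h3 := hadd _ _ _ _ hR (hrefl (k • a • {b} + (N • {b} + a • {f})))
        have e1 : x₀ + (k + 1) • (N • {b} + a • {f})
            = x₀ + k • (N • {b} + a • {f}) + (N • {b} + a • {f}) := by
          rw [succ_nsmul, add_assoc]
        have e2 : x₀ + (k + 1) • a • {b} = y₀ + (k • a • {b} + (N • {b} + a • {f})) := by
          rw [succ_nsmul]
          calc x₀ + (k • a • {b} + a • {b}) = (x₀ + a • {b}) + k • a • {b} := by abel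
            _ = _ := by rw [← h1]; abel
        rw [e1, e2]
        refine htrans _ _ _ h2 ?_
        rw [add_assoc]
        exact h3
    obtain ⟨m₀, hm₀⟩ := exists_rel_nsmul_singleton hzero hadd hbdd x₀
    obtain ⟨M₀, hM₀⟩ := hbdd f
    set m := m₀ + 1 with hm
    set M := M₀ + 1 with hM
    have hxm : R x₀ (m • {b}) := htrans _ _ _ hm₀ (hle _ _ (by simp [hm, add_nsmul]))
    have hfM : R {f} (M • {b}) := htrans _ _ _ hM₀ (hle _ _ (by simp [hM, add_nsmul]))
    -- Absorb `x₀` on the right and replace the surplus copies of `b` on the left by copies of `f`.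
    have main : ∀ k : ℕ, R ((N * k + M * (k * a)) • {f}) ((M * (m + k * a)) • {b}) := by
      intro k
      have h2 : R (k • (N • {b} + a • {f})) ((m + k * a) • {b}) := by
        refine htrans _ _ _ (htrans _ _ _ (hle _ _ (Multiset.le_add_left _ _)) (iter k)) ?_
        rw [add_nsmul, mul_nsmul']
        exact hadd _ _ _ _ hxm (hrefl _)
      have h3 := rel_nsmul hzero hadd h2 M
      have h4 := hadd _ _ _ _ (rel_nsmul hzero hadd hfM (N * k))
        (hrefl ((M * (k * a)) • {f}))
      rw [add_nsmul, mul_nsmul' _ M (m + k * a)]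
      refine htrans _ _ _ h4 ?_
      convert h3 using 1
      simp only [smul_add, smul_smul]
      congr 2
      ring
    refine hnot (M * (m + (M * m + 1) * a)) (by positivity) ?_
    refine htrans _ _ _ (hle _ _ ?_) (main (M * m + 1))
    refine nsmul_le_nsmul_left zero_le ?_
    have : M * m + 1 ≤ N * (M * m + 1) := Nat.le_mul_of_pos_left _ hN
    rw [mul_add]
    omega
  obtain ⟨φ, hφ, hφb⟩ := exists_functional (fun x => hRR' _ _ (hzero x)) hadd' b
    (fun i => (hbdd i).imp fun m hm => hRR' _ _ hm) hstrict
  refine ⟨φ, fun x y h => hφ x y (hRR' x y h), hφb, ?_⟩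
  have := hφ {b} {f} ⟨1, 0, 0, hzero 0, by simp, by simp⟩
  simpa [hφb] using this

end Functional

/-! ### Subequivalence of finite families of sets -/

section Subequivalence

variable (G : Type*) {X : Type*} [Group G] [MulAction G X] [TopologicalSpace X]

/-- Subequivalence of two families of arbitrary subsets of `X`: whenever the members of `T` are
enlarged to open sets `V`, the members of `S` have open covers whose pieces can be translated
disjointly into the levels of `V`. The piece `U j` belongs to the cover of `S (i j)` and is moved
into the level `k j`. As the target is only tested through its open neighbourhoods, the relation
is transitive without any shrinking of the covers. -/
def FamilySubeq {α β : Type} (S : α → Set X) (T : β → Set X) : Prop :=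
  ∀ V : β → Set X, (∀ b, IsOpen (V b)) → (∀ b, T b ⊆ V b) →
    ∃ (J : Type) (_ : Finite J) (i : J → α) (U : J → Set X) (s : J → G) (k : J → β),
      (∀ j, IsOpen (U j)) ∧
      (∀ a, ∀ x ∈ S a, ∃ j, i j = a ∧ x ∈ U j) ∧
      (∀ j, s j • U j ⊆ V (k j)) ∧
      (∀ j j', k j = k j' → ∀ x, x ∈ s j • U j → x ∈ s j' • U j' → j = j')

variable {G}

theorem FamilySubeq.trans [ContinuousConstSMul G X] {α β γ : Type} {S : α → Set X}
    {T : β → Set X} {Z : γ → Set X} (h : FamilySubeq G S T) (h' : FamilySubeq G T Z) :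
    FamilySubeq G S Z := by
  intro V hV hZV
  obtain ⟨J', hJ', i', U', s', k', hU', hc', hs', hd'⟩ := h' V hV hZV
  obtain ⟨J, hJ, i, U, s, k, hU, hc, hs, hd⟩ := h (fun b => ⋃ j ∈ {j | i' j = b}, U' j)
    (fun b => isOpen_biUnion fun j _ => hU' j) (fun b x hx => by
      obtain ⟨j, hj, hxj⟩ := hc' b x hx
      exact Set.mem_biUnion (show j ∈ {j | i' j = b} from hj) hxj)
  have key : ∀ p : {p : J × J' // i' p.2 = k p.1}, ∀ x,
      x ∈ (s' p.1.2 * s p.1.1) • (U p.1.1 ∩ (s p.1.1)⁻¹ • U' p.1.2) →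
      (s' p.1.2)⁻¹ • x ∈ s p.1.1 • U p.1.1 ∧ x ∈ s' p.1.2 • U' p.1.2 := by
    intro p x hx
    rw [mul_smul, Set.mem_smul_set_iff_inv_smul_mem, Set.smul_set_inter, smul_inv_smul] at hx
    exact ⟨hx.1, Set.mem_smul_set_iff_inv_smul_mem.2 hx.2⟩
  refine ⟨{p : J × J' // i' p.2 = k p.1}, inferInstance, fun p => i p.1.1,
    fun p => U p.1.1 ∩ (s p.1.1)⁻¹ • U' p.1.2, fun p => s' p.1.2 * s p.1.1, fun p => k' p.1.2,
    fun p => (hU _).inter ((hU' _).smul _), ?_, ?_, ?_⟩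
  · intro a x hx
    obtain ⟨j, hj, hxj⟩ := hc a x hx
    have h1 := hs j (Set.smul_mem_smul_set hxj)
    simp only [Set.mem_iUnion, Set.mem_ofPred_eq, exists_prop] at h1
    obtain ⟨j', hj', hxj'⟩ := h1
    exact ⟨⟨(j, j'), hj'⟩, hj, hxj, Set.mem_smul_set_iff_inv_smul_mem.2 (by simpa using hxj')⟩
  · intro p x hx
    exact hs' _ (key p x hx).2
  · intro p q hpq x hxp hxq
    have h2 : p.1.2 = q.1.2 := hd' _ _ hpq x (key p x hxp).2 (key q x hxq).2
    have h1 : p.1.1 = q.1.1 := by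
      refine hd _ _ (by rw [← p.2, ← q.2, h2]) _ (key p x hxp).1 ?_
      rw [h2]
      exact (key q x hxq).1
    exact Subtype.ext (Prod.ext h1 h2)

theorem FamilySubeq.sum {α β α' β' : Type} {S : α → Set X} {T : β → Set X} {S' : α' → Set X}
    {T' : β' → Set X} (h : FamilySubeq G S T) (h' : FamilySubeq G S' T') :
    FamilySubeq G (Sum.elim S S') (Sum.elim T T') := by
  intro V hV hTV
  obtain ⟨J, hJ, i, U, s, k, hU, hc, hs, hd⟩ :=
    h (V ∘ Sum.inl) (fun b => hV _) (fun b => hTV (Sum.inl b))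
  obtain ⟨J', hJ', i', U', s', k', hU', hc', hs', hd'⟩ :=
    h' (V ∘ Sum.inr) (fun b => hV _) (fun b => hTV (Sum.inr b))
  refine ⟨J ⊕ J', inferInstance, Sum.map i i', Sum.elim U U', Sum.elim s s', Sum.map k k',
    ?_, ?_, ?_, ?_⟩
  · rintro (j | j)
    exacts [hU j, hU' j]
  · rintro (a | a) x hx
    · obtain ⟨j, rfl, hxj⟩ := hc a x hx
      exact ⟨Sum.inl j, rfl, hxj⟩
    · obtain ⟨j, rfl, hxj⟩ := hc' a x hx
      exact ⟨Sum.inr j, rfl, hxj⟩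
  · rintro (j | j)
    exacts [hs j, hs' j]
  · rintro (j | j) (j' | j') hk x hx hx'
    · exact congrArg _ (hd j j' (Sum.inl_injective hk) x hx hx')
    · exact absurd hk (by simp)
    · exact absurd hk (by simp)
    · exact congrArg _ (hd' j j' (Sum.inr_injective hk) x hx hx')

/-- A family is subequivalent to any family obtained from it by permuting and translating the
members, enlarging them, and adding new ones. -/
theorem FamilySubeq.of_injective {α β : Type} [Finite α] [ContinuousConstSMul G X]
    {S : α → Set X} {T : β → Set X} (e : α → β) (he : Function.Injective e) (g : α → G)
    (h : ∀ a, g a • S a ⊆ T (e a)) : FamilySubeq G S T := by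
  intro V hV hTV
  refine ⟨α, inferInstance, id, fun a => (g a)⁻¹ • V (e a), g, e, fun a => (hV _).smul _,
    fun a x hx => ⟨a, rfl, ?_⟩, fun a => by simp, fun a a' haa' _ _ _ => he haa'⟩
  exact Set.mem_smul_set_iff_inv_smul_mem.2 (by simpa using hTV _ (h a (Set.smul_mem_smul_set hx)))

/-- A single set is subequivalent to any family whose translates cover it. -/
theorem FamilySubeq.of_cover {β : Type} [Finite β] [ContinuousConstSMul G X] {S : Set X}
    {T : β → Set X} (g : β → G) (h : S ⊆ ⋃ b, g b • T b) :
    FamilySubeq G (fun _ : Unit => S) T := by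
  intro V hV hTV
  refine ⟨β, inferInstance, fun _ => (), fun b => g b • V b, fun b => (g b)⁻¹, id,
    fun b => (hV b).smul _, fun a x hx => ?_, fun b => by simp, fun b b' h _ _ _ => h⟩
  obtain ⟨b, hb⟩ := Set.mem_iUnion.1 (h hx)
  exact ⟨b, rfl, Set.smul_set_mono (hTV b) hb⟩

/-- Two disjoint compact sets together are subequivalent to their union. -/
theorem FamilySubeq.of_disjoint [T2Space X] {K L : Set X} (hK : IsCompact K) (hL : IsCompact L)
    (hKL : Disjoint K L) :
    FamilySubeq G (fun b : Bool => cond b K L) (fun _ : Unit => K ∪ L) := by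
  intro V hV hTV
  obtain ⟨U, W, hU, hW, hKU, hLW, hUW⟩ := SeparatedNhds.of_isCompact_isCompact hK hL hKL
  refine ⟨Bool, inferInstance, id, fun b => V () ∩ cond b U W, fun _ => 1, fun _ => (), ?_, ?_, ?_,
    ?_⟩
  · rintro (_ | _)
    exacts [(hV _).inter hW, (hV _).inter hU]
  · rintro (_ | _) x hx
    · exact ⟨false, rfl, hTV () (Or.inr hx), hLW hx⟩
    · exact ⟨true, rfl, hTV () (Or.inl hx), hKU hx⟩
  · intro b
    rw [one_smul]
    exact Set.inter_subset_left
  · rintro (_ | _) (_ | _) - x hx hx'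
    · rfl
    · rw [one_smul] at hx hx'
      exact (Set.disjoint_left.1 hUW hx'.2 hx.2).elim
    · rw [one_smul] at hx hx'
      exact (Set.disjoint_left.1 hUW hx.2 hx'.2).elim
    · rfl

/-- Subequivalence of a family of copies of a set `S ⊇ A` to copies of an open set gives the
relation `p A ≺ q B`. -/
theorem FamilySubeq.multPrec {α β : Type} [Finite α] [Finite β] {p q : ℕ} {A S B : Set X}
    (hAS : A ⊆ S) (hB : IsOpen B) (e : α ≃ Fin p) (e' : β ≃ Fin q)
    (h : FamilySubeq G (fun _ : α => S) (fun _ : β => B)) : MultPrec G p A q B := by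
  intro F hF hFA
  obtain ⟨J, hJ, i, U, s, k, hU, hc, hs, hd⟩ := h (fun _ => B) (fun _ => hB) (fun _ => subset_rfl)
  let c : (a : Fin p) → {j // i j = e.symm a} ≃ Fin (Nat.card {j // i j = e.symm a}) :=
    fun a => Finite.equivFin _
  refine ⟨fun a => Nat.card {j // i j = e.symm a}, fun a t => U ((c a).symm t),
    fun a t => s ((c a).symm t), fun a t => e' (k ((c a).symm t)), fun a t => hU _, ?_, ?_, ?_⟩
  · intro a x hx
    obtain ⟨j, hj, hxj⟩ := hc (e.symm a) x (hAS (hFA a hx))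
    exact Set.mem_iUnion.2 ⟨c a ⟨j, hj⟩, by simpa using hxj⟩
  · rintro ⟨a, t⟩ ⟨a', t'⟩ hne
    refine Set.disjoint_left.2 ?_
    rintro ⟨x, l⟩ ⟨hx, hl⟩ ⟨hx', hl'⟩
    apply hne
    have hl : l = e' (k ((c a).symm t)) := hl
    have hl' : l = e' (k ((c a').symm t')) := hl'
    have hj := hd _ _ (e'.injective (hl.symm.trans hl')) x hx hx'
    have ha : a = a' := by
      have h1 := ((c a).symm t).2
      have h2 := ((c a').symm t').2
      rw [hj, h2] at h1
      exact (e.symm.injective h1).symm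
    subst ha
    rw [(c a).symm.injective (Subtype.ext hj)]
  · rintro ⟨x, l⟩ hx
    simp only [Set.mem_iUnion] at hx
    obtain ⟨a, t, hx, hl⟩ := hx
    exact Set.mem_iUnion.2 ⟨l, hs _ hx, rfl⟩

/-- Two finite families with the same multiset of values differ by a bijection of the indices. -/
theorem exists_equiv_of_map_univ_eq {α β γ : Type*} [Fintype α] [Fintype β] {S : α → γ} {T : β → γ}
    (h : Finset.univ.val.map S = Finset.univ.val.map T) : ∃ e : α ≃ β, ∀ a, T (e a) = S a := by
  classical
  have hcard : ∀ c, Nonempty ({a // S a = c} ≃ {b // T b = c}) := by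
    intro c
    have h1 := congrArg (Multiset.count c) h
    rw [Multiset.count_map, Multiset.count_map] at h1
    refine ⟨Fintype.equivOfCardEq ?_⟩
    rw [Fintype.card_subtype, Fintype.card_subtype]
    simpa [Finset.card, Finset.filter, eq_comm] using h1
  let e := fun c => (hcard c).some
  exact ⟨Equiv.ofFiberEquiv e, fun a => Equiv.ofFiberEquiv_map e a⟩

variable (G) in
/-- Subequivalence of multisets of sets, defined through families enumerating them. -/
def MultisetSubeq (x y : Multiset (Set X)) : Prop :=
  ∃ (α β : Type) (_ : Fintype α) (_ : Fintype β) (S : α → Set X) (T : β → Set X),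
    Finset.univ.val.map S = x ∧ Finset.univ.val.map T = y ∧ FamilySubeq G S T

theorem exists_enumeration {γ : Type*} (x : Multiset γ) :
    ∃ (n : ℕ) (S : Fin n → γ), Finset.univ.val.map S = x := by
  induction x using Quotient.inductionOn with
  | h l => exact ⟨l.length, l.get, by simp⟩

theorem MultisetSubeq.trans [ContinuousConstSMul G X] {x y z : Multiset (Set X)}
    (h : MultisetSubeq G x y) (h' : MultisetSubeq G y z) : MultisetSubeq G x z := by
  obtain ⟨α, β, _, _, S, T, hS, hT, hR⟩ := h
  obtain ⟨β', γ, _, _, T', Z, hT', hZ, hR'⟩ := h'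
  obtain ⟨e, he⟩ := exists_equiv_of_map_univ_eq (hT.trans hT'.symm)
  refine ⟨α, γ, _, _, S, Z, hS, hZ, (hR.trans ?_).trans hR'⟩
  exact FamilySubeq.of_injective e e.injective 1 fun b => by simp [he]

theorem MultisetSubeq.add {x y z t : Multiset (Set X)} (h : MultisetSubeq G x y)
    (h' : MultisetSubeq G z t) : MultisetSubeq G (x + z) (y + t) := by
  obtain ⟨α, β, _, _, S, T, rfl, rfl, hR⟩ := h
  obtain ⟨α', β', _, _, S', T', rfl, rfl, hR'⟩ := h'
  have key : ∀ {α β : Type} [Fintype α] [Fintype β] (S : α → Set X) (S' : β → Set X),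
      Finset.univ.val.map (Sum.elim S S') = Finset.univ.val.map S + Finset.univ.val.map S' := by
    intro α β _ _ S S'
    rw [← Finset.univ_disjSum_univ, Finset.val_disjSum, Multiset.disjSum, Multiset.map_add]
    simp
  exact ⟨α ⊕ α', β ⊕ β', inferInstance, inferInstance, _, _, key S S', key T T', hR.sum hR'⟩

theorem MultisetSubeq.refl [ContinuousConstSMul G X] (x : Multiset (Set X)) :
    MultisetSubeq G x x := by
  obtain ⟨n, S, hS⟩ := exists_enumeration x
  exact ⟨Fin n, Fin n, inferInstance, inferInstance, S, S, hS, hS,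
    FamilySubeq.of_injective id Function.injective_id 1 fun b => by simp⟩

theorem MultisetSubeq.zero [ContinuousConstSMul G X] (x : Multiset (Set X)) :
    MultisetSubeq G 0 x := by
  obtain ⟨n, S, hS⟩ := exists_enumeration x
  exact ⟨Empty, Fin n, inferInstance, inferInstance, Empty.elim, S, by simp, hS,
    FamilySubeq.of_injective Empty.elim (fun a => a.elim) 1 fun a => a.elim⟩

theorem MultisetSubeq.of_smul_subset [ContinuousConstSMul G X] {S T : Set X} (g : G)
    (h : g • S ⊆ T) : MultisetSubeq G {S} {T} :=
  ⟨Unit, Unit, inferInstance, inferInstance, fun _ => S, fun _ => T, by simp, by simp,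
    FamilySubeq.of_injective id Function.injective_id (fun _ => g) fun _ => h⟩

theorem MultisetSubeq.union [ContinuousConstSMul G X] (K L : Set X) :
    MultisetSubeq G {K ∪ L} {K, L} :=
  ⟨Unit, Bool, inferInstance, inferInstance, fun _ => K ∪ L, fun b => cond b K L, by simp,
    by simp, FamilySubeq.of_cover 1 (by rw [Set.union_eq_iUnion]; simp)⟩

theorem MultisetSubeq.of_disjoint [T2Space X] {K L : Set X} (hK : IsCompact K) (hL : IsCompact L)
    (hKL : Disjoint K L) : MultisetSubeq G {K, L} {K ∪ L} :=
  ⟨Bool, Unit, inferInstance, inferInstance, fun b => cond b K L, fun _ => K ∪ L, by simp,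
    by simp, FamilySubeq.of_disjoint hK hL hKL⟩

theorem MultisetSubeq.of_cover [ContinuousConstSMul G X] {S T : Set X} (t : Finset G)
    (h : S ⊆ ⋃ g ∈ t, g • T) : MultisetSubeq G {S} (t.card • {T}) := by
  refine ⟨Unit, Fin t.card, inferInstance, inferInstance, fun _ => S, fun _ => T, by simp,
    by simp [Multiset.nsmul_singleton],
    FamilySubeq.of_cover (fun b => (t.equivFin.symm b : G)) fun x hx => ?_⟩
  obtain ⟨g, hg, hx⟩ := Set.mem_iUnion₂.1 (h hx)
  exact Set.mem_iUnion.2 ⟨t.equivFin ⟨g, hg⟩, by simpa using hx⟩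

theorem MultisetSubeq.multPrec {p q : ℕ} {A S B : Set X} (hAS : A ⊆ S)
    (hB : IsOpen B) (h : MultisetSubeq G (p • {S}) (q • {B})) : MultPrec G p A q B := by
  have key : ∀ {α : Type} [Fintype α] {T : α → Set X} {n : ℕ} {C : Set X},
      Finset.univ.val.map T = n • {C} → Nonempty (α ≃ Fin n) ∧ T = fun _ => C := by
    intro α _ T n C h
    rw [Multiset.nsmul_singleton] at h
    refine ⟨⟨Fintype.equivFinOfCardEq ?_⟩, funext fun a => ?_⟩
    · simpa using congrArg Multiset.card h
    · refine Multiset.eq_of_mem_replicate (n := n) ?_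
      rw [← h]
      exact Multiset.mem_map_of_mem _ (Finset.mem_univ_val a)
  obtain ⟨α, β, _, _, S', T', hS, hT, hR⟩ := h
  obtain ⟨⟨e⟩, rfl⟩ := key hS
  obtain ⟨⟨e'⟩, rfl⟩ := key hT
  exact hR.multPrec hAS hB e e'

end Subequivalence

/-! ### From failing inequalities to an invariant Radon measure -/

section Measure

open MeasureTheory TopologicalSpace

variable {G X : Type*} [Group G] [MulAction G X]

variable (G) in
/-- `S` is covered by finitely many translates of `B`. -/
def FinitelyCovered (B S : Set X) : Prop :=
  ∃ t : Finset G, S ⊆ ⋃ g ∈ t, g • B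

theorem FinitelyCovered.union {B S T : Set X} (h : FinitelyCovered G B S)
    (h' : FinitelyCovered G B T) : FinitelyCovered G B (S ∪ T) := by
  classical
  obtain ⟨t, ht⟩ := h
  obtain ⟨t', ht'⟩ := h'
  refine ⟨t ∪ t', ?_⟩
  rw [Finset.set_biUnion_union]
  exact Set.union_subset_union ht ht'

theorem FinitelyCovered.self (B : Set X) : FinitelyCovered G B B :=
  ⟨{1}, by simp⟩

theorem mem_iUnion_smul_iff_smul_mem (g : G) {B : Set X} (x : X) :
    x ∈ (⋃ g : G, g • B) ↔ g • x ∈ (⋃ g : G, g • B) := by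
  simp only [Set.mem_iUnion, Set.mem_smul_set_iff_inv_smul_mem]
  constructor
  · rintro ⟨h, hx⟩
    exact ⟨g * h, by simpa [mul_smul] using hx⟩
  · rintro ⟨h, hx⟩
    exact ⟨g⁻¹ * h, by simpa [mul_smul] using hx⟩

variable [TopologicalSpace X]

theorem FinitelyCovered.of_isCompact [ContinuousConstSMul G X] {B K : Set X} (hB : IsOpen B)
    (hK : IsCompact K) (hKB : K ⊆ ⋃ g : G, g • B) : FinitelyCovered G B K :=
  hK.elim_finite_subcover _ (fun g => hB.smul g) hKB

/-- If `(n + 1) F ≤ n B` fails for all `n`, there is a function on sets which, on the sets covered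
by finitely many translates of `B`, is nonnegative, monotone, invariant, subadditive, and additive
on disjoint compact sets, and which has the value `1` at `B` and a value `≥ 1` at `F`. -/
theorem exists_setFunction [ContinuousConstSMul G X] [T2Space X] {B F : Set X}
    (hF : FinitelyCovered G B F)
    (hnot : ∀ n : ℕ, 0 < n → ¬ MultisetSubeq G ((n + 1) • {F}) (n • {B})) :
    ∃ φ : Set X → ℝ, (∀ S, 0 ≤ φ S) ∧
      (∀ (g : G) (S T), FinitelyCovered G B S → FinitelyCovered G B T → g • S ⊆ T → φ S ≤ φ T) ∧
      (∀ S T, FinitelyCovered G B S → FinitelyCovered G B T → φ (S ∪ T) ≤ φ S + φ T) ∧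
      (∀ K L, FinitelyCovered G B K → FinitelyCovered G B L → IsCompact K → IsCompact L →
        Disjoint K L → φ K + φ L ≤ φ (K ∪ L)) ∧ φ B = 1 ∧ 1 ≤ φ F := by
  classical
  let ι := {S : Set X // FinitelyCovered G B S}
  let b : ι := ⟨B, .self B⟩
  let f : ι := ⟨F, hF⟩
  let R : Multiset ι → Multiset ι → Prop := fun x y =>
    MultisetSubeq G (x.map Subtype.val) (y.map Subtype.val)
  obtain ⟨φ, hφ, hφb, hφf⟩ := exists_functional_one_le (R := R) (fun x => .refl _)
    (fun x y z h h' => h.trans h') (fun x => .zero _)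
    (fun x y z t h h' => by simpa only [R, Multiset.map_add] using h.add h') b f
    (fun ⟨S, t, ht⟩ => ⟨t.card, by
      simpa [R, b, Multiset.map_nsmul] using MultisetSubeq.of_cover t ht⟩)
    (fun n hn h => hnot n hn (by simpa [R, b, f, Multiset.map_nsmul] using h))
  obtain ⟨ψ, e, e₀⟩ : ∃ ψ : Set X → ℝ, (∀ {S} (h : FinitelyCovered G B S), ψ S = φ ⟨S, h⟩) ∧
      ∀ {S}, ¬ FinitelyCovered G B S → ψ S = 0 :=
    ⟨fun S => if h : FinitelyCovered G B S then φ ⟨S, h⟩ else 0, fun h => dif_pos h,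
      fun h => dif_neg h⟩
  refine ⟨ψ, ?_, ?_, ?_, ?_, ?_, ?_⟩
  · intro S
    by_cases h : FinitelyCovered G B S
    · rw [e h]
      simpa using hφ 0 {⟨S, h⟩} (.zero _)
    · exact (e₀ h).ge
  · intro g S T hS hT hST
    rw [e hS, e hT]
    simpa using hφ {⟨S, hS⟩} {⟨T, hT⟩} (by simpa [R] using MultisetSubeq.of_smul_subset g hST)
  · intro S T hS hT
    rw [e hS, e hT, e (hS.union hT)]
    simpa using hφ {⟨S ∪ T, hS.union hT⟩} {⟨S, hS⟩, ⟨T, hT⟩}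
      (by simpa [R] using MultisetSubeq.union S T)
  · intro K L hK hL hKc hLc hd
    rw [e hK, e hL, e (hK.union hL)]
    simpa using hφ {⟨K, hK⟩, ⟨L, hL⟩} {⟨K ∪ L, hK.union hL⟩}
      (by simpa [R] using MultisetSubeq.of_disjoint hKc hLc hd)
  · rw [e (.self B)]
    exact hφb
  · rw [e hF]
    exact hφf

/-- The set function of `exists_setFunction` restricts to a content on the open invariant set
`G • B`, which is locally compact; the measure of this content is the desired one. -/
theorem exists_invariant_measure [CompactSpace X] [T2Space X] [ContinuousConstSMul G X]
    [MeasurableSpace X] [BorelSpace X] {B F : Set X} (hB : IsOpen B) (hF : IsClosed F)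
    (hFB : F ⊆ ⋃ g : G, g • B)
    (hnot : ∀ n : ℕ, 0 < n → ¬ MultisetSubeq G ((n + 1) • {F}) (n • {B})) :
    ∃ ν : Measure ↥(⋃ g : G, g • B), ν.Regular ∧
      (∀ (g : G) (E : Set X), MeasurableSet E →
        ν (Subtype.val ⁻¹' (g • E)) = ν (Subtype.val ⁻¹' E)) ∧
      ν (Subtype.val ⁻¹' B) ≤ 1 ∧ 1 ≤ ν (Subtype.val ⁻¹' F) := by
  obtain ⟨φ, hnonneg, hmono, hunion, hdisj, hφB, hφF⟩ :=
    exists_setFunction (.of_isCompact hB hF.isCompact hFB) hnot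
  set Y : Set X := ⋃ g : G, g • B with hY
  have hYo : IsOpen Y := isOpen_iUnion fun g => hB.smul g
  have : LocallyCompactSpace Y := hYo.locallyCompactSpace
  have hcK : ∀ K : Compacts Y, IsCompact (Subtype.val '' (K : Set Y)) := fun K =>
    K.isCompact.image continuous_subtype_val
  have hcov : ∀ K : Compacts Y, FinitelyCovered G B (Subtype.val '' (K : Set Y)) := fun K =>
    .of_isCompact hB (hcK K) (by rintro _ ⟨y, -, rfl⟩; exact y.2)
  let c : Content Y :=
    { toFun := fun K => (φ (Subtype.val '' (K : Set Y))).toNNReal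
      mono' := fun K L h => Real.toNNReal_mono (hmono 1 _ _ (hcov K) (hcov L) (by
        rw [one_smul]
        exact Set.image_mono h))
      sup_disjoint' := fun K L h _ _ => by
        rw [← Real.toNNReal_add (hnonneg _) (hnonneg _), Compacts.coe_sup, Set.image_union]
        exact congrArg _ (le_antisymm (hunion _ _ (hcov K) (hcov L))
          (hdisj _ _ (hcov K) (hcov L) (hcK K) (hcK L)
            ((Set.disjoint_image_iff Subtype.val_injective).2 h)))
      sup_le' := fun K L => by
        rw [← Real.toNNReal_add (hnonneg _) (hnonneg _), Compacts.coe_sup, Set.image_union]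
        exact Real.toNNReal_mono (hunion _ _ (hcov K) (hcov L)) }
  have hc : ∀ K, c K = ENNReal.ofReal (φ (Subtype.val '' (K : Set Y))) := fun K => rfl
  refine ⟨c.measure, inferInstance, ?_, ?_, ?_⟩
  · intro g E hE
    let f : Y ≃ₜ Y := (Homeomorph.smul g⁻¹).subtype fun x => mem_iUnion_smul_iff_smul_mem g⁻¹ x
    have hf : ∀ y : Y, (f y : X) = g⁻¹ • (y : X) := fun y => rfl
    have hpre : (Subtype.val ⁻¹' (g • E) : Set Y) = f ⁻¹' (Subtype.val ⁻¹' E) := by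
      ext y
      simp [Set.mem_smul_set_iff_inv_smul_mem, hf]
    have hm : MeasurableSet (Subtype.val ⁻¹' E : Set Y) := measurable_subtype_coe hE
    rw [hpre, c.measure_apply hm, c.measure_apply (f.continuous.measurable hm),
      c.outerMeasure_preimage]
    intro K
    have himg : Subtype.val '' (K.map f f.continuous : Set Y) =
        g⁻¹ • Subtype.val '' (K : Set Y) := by
      ext x
      simp only [Compacts.coe_map, Set.image_image, hf, Set.mem_image, Set.mem_smul_set,
        exists_exists_and_eq_and]
    rw [hc, hc]
    congr 1
    refine le_antisymm (hmono g _ _ (hcov _) (hcov _) ?_) (hmono g⁻¹ _ _ (hcov _) (hcov _) ?_)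
    · rw [himg, smul_inv_smul]
    · rw [himg]
  · have ho : IsOpen (Subtype.val ⁻¹' B : Set Y) := hB.preimage continuous_subtype_val
    rw [c.measure_apply ho.measurableSet, c.outerMeasure_of_isOpen _ ho]
    refine iSup₂_le fun K hK => ?_
    rw [hc, ← ENNReal.ofReal_one, ← hφB]
    refine ENNReal.ofReal_le_ofReal (hmono 1 _ _ (hcov K) (.self B) ?_)
    rw [one_smul]
    exact Set.image_subset_iff.2 hK
  · have himg : Subtype.val '' (Subtype.val ⁻¹' F : Set Y) = F := by
      rw [Subtype.image_preimage_coe, Set.inter_eq_right.2 hFB]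
    have hK : IsCompact (Subtype.val ⁻¹' F : Set Y) := by
      rw [Subtype.isCompact_iff, himg]
      exact hF.isCompact
    rw [c.measure_apply hK.measurableSet]
    refine le_trans ?_ (c.le_outerMeasure_compacts ⟨_, hK⟩)
    rw [hc, ← ENNReal.ofReal_one]
    refine ENNReal.ofReal_le_ofReal ?_
    simpa [himg] using hφF

open Classical in
/-- The extension of a measure on `Y ⊆ X` to subsets of `X` by the value `∞` on all sets which are
not contained in `Y`. -/
noncomputable def extendByTop [MeasurableSpace X] {Y : Set X} (ν : Measure Y) (E : Set X) : ℝ≥0∞ :=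
  if E ⊆ Y then ν (Subtype.val ⁻¹' E) else ∞

theorem measurableSet_of_mem_openAlgebra [MeasurableSpace X] [BorelSpace X] {E : Set X}
    (hE : E ∈ openAlgebra X) : MeasurableSet E := by
  induction hE with
  | base s hs => exact IsOpen.measurableSet hs
  | empty => exact .empty
  | compl s _ hs => exact hs.compl
  | union s t _ _ hs ht => exact hs.union ht

theorem isInvariantRegularPremeasure_extendByTop [CompactSpace X]
    [SecondCountableTopology X] [T2Space X]
    [MeasurableSpace X] [BorelSpace X] {Y : Set X} (hY : IsOpen Y)
    (hYG : ∀ (g : G) (E : Set X), g • E ⊆ Y ↔ E ⊆ Y) (ν : Measure Y) [ν.Regular]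
    (hν : ∀ (g : G) (E : Set X), MeasurableSet E →
      ν (Subtype.val ⁻¹' (g • E)) = ν (Subtype.val ⁻¹' E)) :
    IsInvariantRegularPremeasure G (extendByTop ν) := by
  have : LocallyCompactSpace Y := hY.locallyCompactSpace
  refine ⟨⟨?_, ?_⟩, ?_, ?_, ?_⟩
  · simp [extendByTop]
  · intro A hA hd _
    simp only [extendByTop]
    by_cases h : ⋃ n, A n ⊆ Y
    · rw [if_pos h, Set.preimage_iUnion, measure_iUnion
        (fun i j hij => (hd hij).preimage _)
        (fun n => measurable_subtype_coe (measurableSet_of_mem_openAlgebra (hA n)))]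
      exact tsum_congr fun n => (if_pos ((Set.subset_iUnion A n).trans h)).symm
    · rw [if_neg h]
      rw [Set.iUnion_subset_iff] at h
      push Not at h
      obtain ⟨n, hn⟩ := h
      exact (ENNReal.tsum_eq_top_of_eq_top ⟨n, if_neg hn⟩).symm
  · intro g E hE
    simp only [extendByTop, hν g E (measurableSet_of_mem_openAlgebra hE)]
    by_cases h : E ⊆ Y
    · rw [if_pos h, if_pos ((hYG g E).2 h)]
    · rw [if_neg h, if_neg (mt (hYG g E).1 h)]
  · intro E hE
    refine le_antisymm ?_ (iSup_le fun F => iSup₂_le fun hFE _ => ?_)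
    · by_cases h : E ⊆ Y
      · have hm : MeasurableSet (Subtype.val ⁻¹' E : Set Y) :=
          measurable_subtype_coe (measurableSet_of_mem_openAlgebra hE)
        rw [extendByTop, if_pos h, hm.measure_eq_iSup_isCompact]
        refine iSup_le fun K => iSup₂_le fun hKE hK => ?_
        have hKE' : Subtype.val '' K ⊆ E := Set.image_subset_iff.2 hKE
        refine le_iSup_of_le (Subtype.val '' K) (le_iSup₂_of_le hKE'
          (hK.image continuous_subtype_val) ?_)
        rw [extendByTop, if_pos (hKE'.trans h), Set.preimage_image_eq _ Subtype.val_injective]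
      · obtain ⟨x, hx, hxY⟩ := Set.not_subset.1 h
        refine le_iSup_of_le {x} (le_iSup₂_of_le (Set.singleton_subset_iff.2 hx)
          isCompact_singleton ?_)
        rw [extendByTop, extendByTop, if_neg h, if_neg (by simpa using hxY)]
    · simp only [extendByTop]
      split_ifs with h1 h2 h2
      · exact measure_mono (Set.preimage_mono hFE)
      · exact le_top
      · exact absurd (hFE.trans h2) h1
      · exact le_rfl
  · intro E hE
    refine le_antisymm (le_iInf fun O => le_iInf₂ fun hEO _ => ?_) ?_
    · simp only [extendByTop]
      split_ifs with h1 h2 h2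
      · exact measure_mono (Set.preimage_mono hEO)
      · exact le_top
      · exact absurd (hEO.trans h2) h1
      · exact le_rfl
    · by_cases h : E ⊆ Y
      · rw [extendByTop, if_pos h, Set.measure_eq_iInf_isOpen]
        refine le_iInf fun O => le_iInf₂ fun hEO hO => ?_
        have hOo : IsOpen (Subtype.val '' O : Set X) := hY.isOpenMap_subtype_val _ hO
        have hEO' : E ⊆ Subtype.val '' O := fun x hx => ⟨⟨x, h hx⟩, hEO hx, rfl⟩
        refine iInf_le_of_le (Subtype.val '' O) (iInf₂_le_of_le hEO' hOo ?_)
        rw [extendByTop, if_pos (by rintro _ ⟨y, -, rfl⟩; exact y.2),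
          Set.preimage_image_eq _ Subtype.val_injective]
      · rw [extendByTop, if_neg h]
        exact le_top

end Measure

/-! ### Finitely additive consequences of the premeasure axioms -/

section Premeasure

theorem isSetAlgebra_openAlgebra (X : Type*) [TopologicalSpace X] :
    MeasureTheory.IsSetAlgebra (openAlgebra X) :=
  MeasureTheory.isSetAlgebra_generateSetAlgebra

theorem mem_openAlgebra_of_isOpen {X : Type*} [TopologicalSpace X] {O : Set X} (hO : IsOpen O) :
    O ∈ openAlgebra X :=
  MeasureTheory.self_subset_generateSetAlgebra hO

variable {X : Type*} {μ : Set X → ℝ≥0∞}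

theorem IsPremeasure.iUnion_fintype {𝒜 : Set (Set X)} (h𝒜 : MeasureTheory.IsSetAlgebra 𝒜)
    (hμ : IsPremeasure 𝒜 μ) {J : Type*} [Fintype J] (A : J → Set X) (hA : ∀ j, A j ∈ 𝒜)
    (hd : Pairwise (Function.onFun Disjoint A)) : μ (⋃ j, A j) = ∑ j, μ (A j) := by
  classical
  let e := Fintype.equivFin J
  let A' : ℕ → Set X := fun n => if h : n < Fintype.card J then A (e.symm ⟨n, h⟩) else ∅
  have hA' : ∀ n, A' n ∈ 𝒜 := by
    intro n
    by_cases h : n < Fintype.card J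
    · simp only [A', dif_pos h, hA]
    · simp only [A', dif_neg h, h𝒜.empty_mem]
  have hval : ∀ j, A' (e j) = A j := by
    intro j
    simp [A']
  have hU : ⋃ n, A' n = ⋃ j, A j := by
    refine subset_antisymm (Set.iUnion_subset fun n => ?_) (Set.iUnion_subset fun j => ?_)
    · by_cases h : n < Fintype.card J
      · simp only [A', dif_pos h]
        exact Set.subset_iUnion _ _
      · simp only [A', dif_neg h, Set.empty_subset]
    · rw [← hval]
      exact Set.subset_iUnion _ _
  have hd' : Pairwise (Function.onFun Disjoint A') := by
    intro m n hmn
    by_cases hm : m < Fintype.card J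
    · by_cases hn : n < Fintype.card J
      · simp only [Function.onFun, A', dif_pos hm, dif_pos hn]
        exact hd (by simpa using hmn)
      · simp [Function.onFun, A', dif_neg hn]
    · simp [Function.onFun, A', dif_neg hm]
  have hmem : ⋃ n, A' n ∈ 𝒜 := by
    rw [hU]
    simpa using h𝒜.biUnion_mem Finset.univ fun j _ => hA j
  rw [← hU, hμ.iUnion A' hA' hd' hmem,
    tsum_eq_sum (s := Finset.range (Fintype.card J)) fun n hn => ?_, Finset.sum_range,
    ← e.sum_comp]
  · exact Finset.sum_congr rfl fun j _ => by rw [hval]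
  · have : ¬ n < Fintype.card J := by simpa using hn
    simp only [A', dif_neg this, hμ.empty]

theorem IsPremeasure.union_disjoint {𝒜 : Set (Set X)} (h𝒜 : MeasureTheory.IsSetAlgebra 𝒜)
    (hμ : IsPremeasure 𝒜 μ) {A B : Set X} (hA : A ∈ 𝒜) (hB : B ∈ 𝒜) (hd : Disjoint A B) :
    μ (A ∪ B) = μ A + μ B := by
  have := hμ.iUnion_fintype h𝒜 (fun b : Bool => cond b A B) (by rintro (_ | _) <;> assumption) (by
    rintro (_ | _) (_ | _) h
    exacts [absurd rfl h, hd.symm, hd, absurd rfl h])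
  simpa [Set.union_eq_iUnion] using this

theorem IsPremeasure.mono {𝒜 : Set (Set X)} (h𝒜 : MeasureTheory.IsSetAlgebra 𝒜)
    (hμ : IsPremeasure 𝒜 μ) {A B : Set X} (hA : A ∈ 𝒜) (hB : B ∈ 𝒜) (h : A ⊆ B) : μ A ≤ μ B := by
  rw [← Set.union_sdiff_cancel h, hμ.union_disjoint h𝒜 hA (h𝒜.sdiff_mem hB hA)
    Set.disjoint_sdiff_right]
  exact le_self_add

theorem IsPremeasure.le_sum {𝒜 : Set (Set X)} (h𝒜 : MeasureTheory.IsSetAlgebra 𝒜)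
    (hμ : IsPremeasure 𝒜 μ) {J : Type*} (t : Finset J) {A : J → Set X} (hA : ∀ j, A j ∈ 𝒜) :
    μ (⋃ j ∈ t, A j) ≤ ∑ j ∈ t, μ (A j) := by
  classical
  induction t using Finset.induction with
  | empty => simp [hμ.empty]
  | insert j t hj ih =>
    have ht : ⋃ j ∈ t, A j ∈ 𝒜 := h𝒜.biUnion_mem t fun j _ => hA j
    rw [Finset.set_biUnion_insert, Finset.sum_insert hj, ← Set.union_sdiff_self,
      hμ.union_disjoint h𝒜 (hA j) (h𝒜.sdiff_mem ht (hA j)) Set.disjoint_sdiff_right]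
    exact add_le_add le_rfl
      ((hμ.mono h𝒜 (h𝒜.sdiff_mem ht (hA j)) ht Set.sdiff_subset).trans ih)

end Premeasure

/-! ### Comparison and premeasures -/

section Main

variable {G X : Type*} [Group G] [MulAction G X] [TopologicalSpace X]

/-- An invariant premeasure turns `p A ≺ q B` into the inequality `p μ(F) ≤ q μ(B)` for all closed
`F ⊆ A`. -/
theorem MultPrec.mul_le [ContinuousConstSMul G X] {p q : ℕ} {A B F : Set X} {μ : Set X → ℝ≥0∞}
    (h : MultPrec G p A q B) (hμ : IsInvariantRegularPremeasure G μ) (hB : IsOpen B)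
    (hF : IsClosed F) (hFA : F ⊆ A) : p * μ F ≤ q * μ B := by
  have h𝒜 := isSetAlgebra_openAlgebra X
  have hpre := hμ.isPremeasure
  obtain ⟨J, U, s, k, hU, hc, hd, hs⟩ := h (fun _ => F) (fun _ => hF) (fun _ => hFA)
  have hFmem : F ∈ openAlgebra X := by
    simpa using h𝒜.compl_mem (mem_openAlgebra_of_isOpen hF.isOpen_compl)
  have hUmem : ∀ i j, U i j ∈ openAlgebra X := fun i j => mem_openAlgebra_of_isOpen (hU i j)
  let P := (i : Fin p) × Fin (J i)
  have hlevel : ∀ l : Fin q, ∑ a : {a : P // k a.1 a.2 = l}, μ (U a.1.1 a.1.2) ≤ μ B := by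
    intro l
    have hmem : ∀ a : {a : P // k a.1 a.2 = l}, s a.1.1 a.1.2 • U a.1.1 a.1.2 ∈ openAlgebra X :=
      fun a => mem_openAlgebra_of_isOpen ((hU _ _).smul _)
    calc ∑ a : {a : P // k a.1 a.2 = l}, μ (U a.1.1 a.1.2)
        = ∑ a : {a : P // k a.1 a.2 = l}, μ (s a.1.1 a.1.2 • U a.1.1 a.1.2) :=
          Finset.sum_congr rfl fun a _ => (hμ.invariant _ _ (hUmem _ _)).symm
      _ = μ (⋃ a : {a : P // k a.1 a.2 = l}, s a.1.1 a.1.2 • U a.1.1 a.1.2) := by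
          refine (hpre.iUnion_fintype h𝒜 _ hmem ?_).symm
          intro a b hab
          refine Set.disjoint_left.2 fun x hx hx' => ?_
          have := hd (fun h => hab (Subtype.ext h) : a.1 ≠ b.1)
          have hxa : (x, l) ∈ (s a.1.1 a.1.2 • U a.1.1 a.1.2) ×ˢ ({k a.1.1 a.1.2} : Set (Fin q)) :=
            ⟨hx, a.2.symm⟩
          exact Set.disjoint_left.1 this hxa ⟨hx', b.2.symm⟩
      _ ≤ μ B := by
          refine hpre.mono h𝒜 ?_ (mem_openAlgebra_of_isOpen hB) (Set.iUnion_subset fun a x hx => ?_)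
          · simpa using h𝒜.biUnion_mem Finset.univ fun a _ => hmem a
          · have hxa : (x, k a.1.1 a.1.2) ∈ levels fun _ : Fin q => B :=
              hs (Set.mem_iUnion₂.2 ⟨a.1.1, a.1.2, hx, rfl⟩)
            obtain ⟨l', hx', -⟩ := Set.mem_iUnion.1 hxa
            exact hx'
  calc (p : ℝ≥0∞) * μ F = ∑ _i : Fin p, μ F := by simp
    _ ≤ ∑ i : Fin p, ∑ j : Fin (J i), μ (U i j) := by
        refine Finset.sum_le_sum fun i _ => ?_
        refine (hpre.mono h𝒜 hFmem ?_ ?_).trans (hpre.le_sum h𝒜 Finset.univ (hUmem i))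
        · exact h𝒜.biUnion_mem Finset.univ fun j _ => hUmem i j
        · simpa using hc i
    _ = ∑ a : P, μ (U a.1 a.2) := (Fintype.sum_sigma' _).symm
    _ = ∑ l : Fin q, ∑ a : {a : P // k a.1 a.2 = l}, μ (U a.1.1 a.1.2) :=
        (Fintype.sum_fiberwise (fun a : P => k a.1 a.2) _).symm
    _ ≤ ∑ _l : Fin q, μ B := Finset.sum_le_sum fun l _ => hlevel l
    _ = q * μ B := by simp

/-- A positive multiple comparison `(p + 1) A ≺ q B` forces every point of `A` into an orbit
meeting `B`. -/
theorem MultPrec.subset_iUnion_smul [T1Space X] {p q : ℕ} {A B : Set X}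
    (h : MultPrec G (p + 1) A q B) : A ⊆ ⋃ g : G, g • B := by
  intro x hx
  obtain ⟨J, U, s, k, hU, hc, hd, hs⟩ := h (fun _ => {x}) (fun _ => isClosed_singleton)
    (fun _ => Set.singleton_subset_iff.2 hx)
  obtain ⟨j, hj⟩ := Set.mem_iUnion.1 (hc 0 rfl)
  have hsx : (s 0 j • x, k 0 j) ∈ levels fun _ : Fin q => B :=
    hs (Set.mem_iUnion₂.2 ⟨0, j, Set.smul_mem_smul_set hj, rfl⟩)
  obtain ⟨l, hl, -⟩ := Set.mem_iUnion.1 hsx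
  exact Set.mem_iUnion.2 ⟨(s 0 j)⁻¹, Set.mem_smul_set_iff_inv_smul_mem.2 (by simpa using hl)⟩

/-- If `(n + 1) F ≤ n B` fails for all `n`, where the closed set `F` lies in the union of the
translates of `B`, then some invariant regular premeasure normalized at `B` has value at least `1`
at every set between `F` and that union. -/
theorem exists_premeasure [Countable G] [CompactSpace X] [SecondCountableTopology X] [T2Space X]
    [ContinuousConstSMul G X] {B F : Set X} (hB : IsOpen B) (hF : IsClosed F)
    (hFB : F ⊆ ⋃ g : G, g • B)
    (hnot : ∀ n : ℕ, 0 < n → ¬ MultisetSubeq G ((n + 1) • {F}) (n • {B})) :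
    ∃ μ : Set X → ℝ≥0∞, IsInvariantRegularPremeasure G μ ∧ μ B = 1 ∧
      ∀ A, F ⊆ A → A ⊆ ⋃ g : G, g • B → 1 ≤ μ A := by
  borelize X
  obtain ⟨ν, hreg, hinv, hνB, hνF⟩ := exists_invariant_measure hB hF hFB hnot
  have hBY : B ⊆ ⋃ g : G, g • B := fun x hx => Set.mem_iUnion.2 ⟨1, by simpa using hx⟩
  -- `ν B` is positive because countably many sets of the same measure cover the whole space.
  have hpos : ν (Subtype.val ⁻¹' B) ≠ 0 := by
    intro h0
    have : ν (Subtype.val ⁻¹' F) = 0 := by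
      refine MeasureTheory.measure_mono_null (Set.preimage_mono hFB) ?_
      rw [Set.preimage_iUnion]
      exact MeasureTheory.measure_iUnion_null fun g => (hinv g B hB.measurableSet).trans h0
    rw [this] at hνF
    exact absurd hνF (by simp)
  have hne_top : ν (Subtype.val ⁻¹' B) ≠ ∞ := ne_top_of_le_ne_top ENNReal.one_ne_top hνB
  have hc : (ν (Subtype.val ⁻¹' B))⁻¹ ≠ ∞ := ENNReal.inv_ne_top.2 hpos
  have : ((ν (Subtype.val ⁻¹' B))⁻¹ • ν).Regular := MeasureTheory.Measure.Regular.smul hc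
  refine ⟨extendByTop ((ν (Subtype.val ⁻¹' B))⁻¹ • ν),
    isInvariantRegularPremeasure_extendByTop (isOpen_iUnion fun g => hB.smul g) ?_ _ ?_, ?_, ?_⟩
  · intro g E
    constructor
    · intro h x hx
      exact (mem_iUnion_smul_iff_smul_mem g x).2 (h (Set.smul_mem_smul_set hx))
    · rintro h _ ⟨x, hx, rfl⟩
      exact (mem_iUnion_smul_iff_smul_mem g x).1 (h hx)
  · intro g E hE
    simp only [MeasureTheory.Measure.smul_apply, hinv g E hE]
  · rw [extendByTop, if_pos hBY, MeasureTheory.Measure.smul_apply, smul_eq_mul,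
      ENNReal.inv_mul_cancel hpos hne_top]
  · intro A hFA hA
    rw [extendByTop, if_pos hA, MeasureTheory.Measure.smul_apply, smul_eq_mul]
    exact one_le_mul (ENNReal.one_le_inv.2 hνB)
      (hνF.trans (MeasureTheory.measure_mono (Set.preimage_mono hFA)))

end Main

end GenComparison

theorem theoremB {G X : Type*} [Group G] [Countable G] [TopologicalSpace X] [CompactSpace X]
    [TopologicalSpace.MetrizableSpace X] [MulAction G X] [ContinuousConstSMul G X] :
    (∀ A B : Set X, IsOpen A → IsOpen B → A.Nonempty → B.Nonempty →
      (∃ n : ℕ, 0 < n ∧ GenComparison.MultPrec G (n + 1) A n B) →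
      GenComparison.OpenPrec G A B) ↔
    GenComparison.HasGeneralizedDynamicalComparison G X := by
  open GenComparison in
  constructor
  · intro h A B hA hB hAB hμ F hF hFA
    have : SecondCountableTopology X := by
      let _ := TopologicalSpace.metrizableSpaceMetric X
      infer_instance
    obtain rfl | hne := F.eq_empty_or_nonempty
    · exact ⟨∅, fun _ => 1, by simp, by simp, by simp, by simp⟩
    -- `MultPrec` asks for an open set on the left and the premeasure is bounded below on a compact
    -- one; an intermediate open set with closure in `A` serves both.
    obtain ⟨A', hA', hFA', hA'A⟩ := normal_exists_closure_subset hF hA hFA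
    have hex : ∃ n : ℕ, 0 < n ∧ MultisetSubeq G ((n + 1) • {closure A'}) (n • {B}) := by
      by_contra! hnot
      obtain ⟨μ, hμi, hμB, hμA⟩ :=
        exists_premeasure hB isClosed_closure (hA'A.trans hAB) hnot
      exact absurd (hμ μ hμi hμB) (not_lt.2 (hμA A hA'A hAB))
    obtain ⟨n, hn, hR⟩ := hex
    have hBne : B.Nonempty := by
      obtain ⟨x, hx⟩ := hne
      obtain ⟨g, hg⟩ := Set.mem_iUnion.1 (hAB (hFA hx))
      exact ⟨_, Set.mem_smul_set_iff_inv_smul_mem.1 hg⟩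
    exact h A' B hA' hB (hne.mono hFA') hBne ⟨n, hn, hR.multPrec subset_closure hB⟩ F hF hFA'
  · rintro h A B hA hB - - ⟨n, hn, hAB⟩
    refine h A B hA hB hAB.subset_iUnion_smul fun μ hμ hμB => ?_
    -- The bound on closed subsets is uniform, so the strict inequality survives the supremum.
    have hle : μ A ≤ n / (n + 1) := by
      rw [hμ.innerRegular A (mem_openAlgebra_of_isOpen hA)]
      refine iSup_le fun F => iSup₂_le fun hFA hF => ?_
      have := hAB.mul_le hμ hB hF.isClosed hFA
      rw [hμB, mul_one] at this
      rw [ENNReal.le_div_iff_mul_le (by simp) (by simp), mul_comm]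
      exact_mod_cast this
    refine hle.trans_lt (ENNReal.div_lt_of_lt_mul ?_)
    rw [one_mul]
    exact_mod_cast Nat.lt_succ_self n
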